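/- Let $\mathfrak g$ be a finite-dimensional complex simple Lie algebra with Cartan subalgebra $\mathfrak h$, a choice of simple roots indexed by $I$, simple coroots $h_i\in\mathfrak h$, fundamental weights $\omega_i$, dominant integral weights $P^+$, and $\mathfrak n^+$ the sum of the positive root spaces. Fix simple root vectors $x_i^{\pm}\in\mathfrak g_{\pm\alpha_i}$ with $[x_i^+,x_i^-]=h_i$. Let $L(\mathfrak g)=\mathfrak g\otimes\mathbb C[t,t^{-1}]$ be the loop algebra, with $[x\otimes f,y\otimes g]=[x,y]\otimes fg$, and, for $i\in I$, put $$P_i^{\pm}(u)=\exp\Big(-\sum_{k\ge1}\frac{h_i\otimes t^{\pm k}}{k}u^k\Big)\in U(L(\mathfrak g))[[u]].$$ Let $\mathcal P^+$ be the monoid, under componentwise multiplication, of $I$-tuples of polynomials in $\mathbb C[u]$ with constant term $1$. For $\lambda\in P^+$ and $a\in\mathbb C^\times$ let $\pi_{\lambda,a}=\big((1-au)^{\lambda(h_i)}\big)_{i\in I}\in\mathcal P^+$. For $\pi=(\pi_i)_{i\in I}\in\mathcal P^+$ put $\lambda_\pi=\sum_i\deg(\pi_i)\,\omega_i$, $\pi^+=\pi$,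 and let $\pi^-$ be obtained from $\pi$ by replacing each linear factor $1-au$ of each $\pi_i$ by $1-a^{-1}u$. The Weyl module $W(\pi)$ is the $L(\mathfrak g)$-module generated by an element $w_\pi$ with the defining relations $$L(\mathfrak n^+)w_\pi=0,\quad hw_\pi=\lambda_\pi(h)w_\pi,\quad (x_i^-)^{\lambda_\pi(h_i)+1}w_\pi=0,\quad \big(P_i^{\pm}(u)-\pi_i^{\pm}(u)\big)w_\pi=0\qquad(h\in\mathfrak h,\ i\in I).$$ Proposition. For every $\pi\in\mathcal P^+$ there is an integer $N=N(\pi)\ge0$ such that, whenever $\pi=\prod_{r=1}^{\ell}\pi_{\lambda_r,a_r}$ with $\lambda_r\in P^+$ and $a_r\in\mathbb C^\times$, $$\Big(\mathfrak g\otimes\prod_{r=1}^{\ell}(t-a_r)^N\,\mathbb C[t,t^{-1}]\Big)W(\pi)=0 .$$ Hence the action of $L(\mathfrak g)$ on $W(\pi)$ factors through an action of the Lie algebra $$\mathfrak g_{\mathbf a,N}=L(\mathfrak g)\Big/\Big(\mathfrak g\otimes\prod_{r=1}^{\ell}(t-a_r)^N\,\mathbb C[t,t^{-1}]\Big),$$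 which is finite-dimensional. -/

import Mathlib

open scoped TensorProduct LaurentPolynomial Polynomial

attribute [local instance] LieRing.ofAssociativeRing

noncomputable section

namespace LoopWeyl

open LieAlgebra LieAlgebra.IsKilling

universe u

/-! ## The loop algebra and its truncations -/

section Loop

variable (𝔤 : Type u) [LieRing 𝔤] [LieAlgebra ℂ 𝔤]

/-- The loop algebra `L(𝔤) = ℂ[t, t⁻¹] ⊗ 𝔤`, with bracket `[f ⊗ x, g ⊗ y] = f g ⊗ [x, y]`. -/
def Loop : Type u := LieAlgebra.loopAlgebra ℂ ℤ 𝔤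

instance : LieRing (Loop 𝔤) := inferInstanceAs (LieRing (LieAlgebra.loopAlgebra ℂ ℤ 𝔤))

instance : LieAlgebra ℂ (Loop 𝔤) := inferInstanceAs (LieAlgebra ℂ (LieAlgebra.loopAlgebra ℂ ℤ 𝔤))

variable {𝔤} in
/-- The element `f ⊗ x` of the loop algebra. -/
def loopTmul (f : ℂ[T;T⁻¹]) (x : 𝔤) : Loop 𝔤 :=
  (f ⊗ₜ[ℂ] x : LieAlgebra.loopAlgebra ℂ ℤ 𝔤)

theorem lie_loopTmul (f g : ℂ[T;T⁻¹]) (x y : 𝔤) :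
    ⁅loopTmul f x, loopTmul g y⁆ = loopTmul (f * g) ⁅x, y⁆ := rfl

theorem loop_induction {P : Loop 𝔤 → Prop} (zero : P 0)
    (tmul : ∀ f x, P (loopTmul f x)) (add : ∀ y z, P y → P z → P (y + z)) (z : Loop 𝔤) : P z :=
  TensorProduct.induction_on (motive := P) z zero tmul add

/-- The Laurent polynomial `∏ r, (t - a r) ^ N`. -/
def truncPoly {l : ℕ} (a : Fin l → ℂˣ) (N : ℕ) : ℂ[T;T⁻¹] :=
  ∏ r, (LaurentPolynomial.T 1 - LaurentPolynomial.C (a r : ℂ)) ^ N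

/-- The ideal `𝔤 ⊗ ∏ r, (t - a r) ^ N ℂ[t, t⁻¹]` of the loop algebra. -/
def truncIdeal {l : ℕ} (a : Fin l → ℂˣ) (N : ℕ) : LieIdeal ℂ (Loop 𝔤) where
  __ := Submodule.span ℂ
    {z : Loop 𝔤 | ∃ (f : ℂ[T;T⁻¹]) (x : 𝔤), z = loopTmul (truncPoly a N * f) x}
  lie_mem {y z} hz := by
    change z ∈ Submodule.span ℂ _ at hz
    change ⁅y, z⁆ ∈ Submodule.span ℂ _
    induction hz using Submodule.span_induction with
    | mem z hz =>
      obtain ⟨f, x, rfl⟩ := hz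
      induction y using loop_induction with
      | zero => rw [zero_lie]; exact zero_mem _
      | tmul g y =>
        refine Submodule.subset_span ⟨g * f, ⁅y, x⁆, ?_⟩
        rw [lie_loopTmul, mul_left_comm]
      | add y₁ y₂ h₁ h₂ => rw [add_lie]; exact add_mem h₁ h₂
    | zero => rw [lie_zero]; exact zero_mem _
    | add z₁ z₂ _ _ h₁ h₂ => rw [lie_add]; exact add_mem h₁ h₂
    | smul c z _ h => rw [lie_smul]; exact Submodule.smul_mem _ c h

/-- The truncation `𝔤_{a,N}`: the quotient of the loop algebra by `truncIdeal 𝔤 a N`. -/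
abbrev Truncation {l : ℕ} (a : Fin l → ℂˣ) (N : ℕ) : Type u := Loop 𝔤 ⧸ truncIdeal 𝔤 a N

end Loop

/-! ## Power series with coefficients in a possibly noncommutative algebra -/

/-- `exp F = ∑ k, F ^ k / k!` for a power series `F` with zero constant term: then the terms with
`k > m` do not contribute to the coefficient of `u ^ m`. -/
def expSeries {A : Type*} [Ring A] [Algebra ℂ A] (F : PowerSeries A) : PowerSeries A :=
  PowerSeries.mk fun m =>
    ∑ k ∈ Finset.range (m + 1), ((k.factorial : ℂ)⁻¹) • PowerSeries.coeff m (F ^ k)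

section Simple

variable {𝔤 : Type u} [LieRing 𝔤] [LieAlgebra ℂ 𝔤] [FiniteDimensional ℂ 𝔤]
  [LieAlgebra.IsSimple ℂ 𝔤] {H : LieSubalgebra ℂ 𝔤} [H.IsCartanSubalgebra]
  (b : (rootSystem H).Base)

/-! ## Root data. The index set `I` of the simple roots is `b.support`. -/

/-- The simple coroot `h_i`, as an element of the Cartan subalgebra. -/
def simpleCoroot (i : b.support) : H := (rootSystem H).coroot i

/-- The fundamental weights `ω_i`: the basis of `𝔥*` dual to the simple coroots. -/
def fundWeight (i : b.support) : Module.Dual ℂ H := b.toCoweightBasis.coord i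

open Classical in
theorem fundWeight_simpleCoroot (i j : b.support) :
    fundWeight b i (simpleCoroot b j) = if j = i then 1 else 0 := by
  rw [fundWeight, simpleCoroot, Module.Basis.coord_apply, RootPairing.Base.toCoweightBasis_repr_coroot,
    Finsupp.single_apply]

/-- The monoid `P⁺` of dominant integral weights. -/
def DominantWeight : AddSubmonoid (Module.Dual ℂ H) where
  carrier := {μ | ∀ i : b.support, ∃ n : ℕ, μ (simpleCoroot b i) = n}
  zero_mem' _ := ⟨0, by simp⟩
  add_mem' {μ ν} hμ hν i := by
    obtain ⟨m, hm⟩ := hμ i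
    obtain ⟨n, hn⟩ := hν i
    exact ⟨m + n, by simp [hm, hn]⟩

variable {b}

/-- The natural number `μ(h_i)`, for `μ ∈ P⁺`. -/
def weightEval (μ : DominantWeight b) (i : b.support) : ℕ := (μ.2 i).choose

theorem weightEval_spec (μ : DominantWeight b) (i : b.support) :
    (μ : Module.Dual ℂ H) (simpleCoroot b i) = weightEval μ i := (μ.2 i).choose_spec

variable (b)

/-- `𝔫⁺`, the sum of the root spaces of the positive roots. -/
def nPlus : Submodule ℂ 𝔤 :=
  ⨆ α : {α : H.root // b.IsPos α}, (rootSpace H (α.1.1 : H → ℂ)).toSubmodule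

/-- The simple root vectors `x_i^+`, `x_i^-` of a Chevalley basis, with `[x_i^+, x_i^-] = h_i`. -/
structure ChevalleyGenerators where
  xPlus : b.support → 𝔤
  xMinus : b.support → 𝔤
  xPlus_mem : ∀ i, xPlus i ∈ rootSpace H (i.1.1 : H → ℂ)
  xMinus_mem : ∀ i, xMinus i ∈ rootSpace H (-(i.1.1 : H → ℂ))
  lie_xPlus_xMinus : ∀ i, ⁅xPlus i, xMinus i⁆ = (simpleCoroot b i : 𝔤)

/-! ## The monoid `𝒫⁺` -/

/-- The monoid `𝒫⁺` of `I`-tuples of polynomials in one indeterminate `u` with constant term one,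
under componentwise multiplication. -/
def PolyMonoid : Submonoid (b.support → ℂ[X]) where
  carrier := {p | ∀ i, (p i).coeff 0 = 1}
  one_mem' _ := by simp
  mul_mem' hp hq i := by simp [Polynomial.mul_coeff_zero, hp i, hq i]

variable {b}

open Classical in
/-- The element `π_{i,a} = ((1 - a u) ^ δ_{ij})_j` of `𝒫⁺`. -/
def linElem (i : b.support) (a : ℂˣ) : PolyMonoid b :=
  ⟨fun j => if j = i then 1 - Polynomial.C (a : ℂ) * Polynomial.X else 1, fun j => by
    by_cases h : j = i <;> simp [h]⟩

/-- The element `π_{μ,a} = ∏ i, (π_{i,a}) ^ μ(h_i)` of `𝒫⁺`. -/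
def weightElem (μ : DominantWeight b) (a : ℂˣ) : PolyMonoid b :=
  ∏ i, linElem i a ^ weightEval μ i

/-- `π⁻`: each factor `1 - a u` of each `π_i` is replaced by `1 - a⁻¹ u`; observe that `a⁻¹` runs
over the roots of `π_i`, with multiplicity. -/
def minus (p : PolyMonoid b) : PolyMonoid b :=
  ⟨fun i => ((p.1 i).roots.map fun z => 1 - Polynomial.C z * Polynomial.X).prod, fun i => by
    rw [Polynomial.coeff_zero_eq_eval_zero, Polynomial.eval_multiset_prod, Multiset.map_map]
    refine Multiset.prod_eq_one fun y hy => ?_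
    obtain ⟨z, -, rfl⟩ := Multiset.mem_map.1 hy
    simp⟩

theorem PolyMonoid.ne_zero (p : PolyMonoid b) (i : b.support) : p.1 i ≠ 0 := by
  intro h
  have := p.2 i
  simp [h] at this

theorem minus_mul (p q : PolyMonoid b) : minus (p * q) = minus p * minus q := by
  refine Subtype.ext (funext fun i => ?_)
  have h : p.1 i * q.1 i ≠ 0 := mul_ne_zero (PolyMonoid.ne_zero p i) (PolyMonoid.ne_zero q i)
  simp [minus, Polynomial.roots_mul h]

theorem minus_linElem (i : b.support) (a : ℂˣ) :
    minus (linElem i a) = linElem i a⁻¹ := by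
  refine Subtype.ext (funext fun j => ?_)
  by_cases h : j = i
  · have : (1 : Polynomial ℂ) - Polynomial.C (a : ℂ) * Polynomial.X
        = Polynomial.C (-(a:ℂ)) * (Polynomial.X - Polynomial.C ((a⁻¹ : ℂˣ) : ℂ)) := by
      simp [mul_sub, ← Polynomial.C_mul]; ring
    simp only [minus, linElem, h, if_true]
    rw [this, Polynomial.roots_C_mul _ (by simp), Polynomial.roots_X_sub_C]
    simp
  · simp [minus, linElem, h]

/-- The weight `λ_π = ∑ i, deg(π_i) ω_i` attached to `π ∈ 𝒫⁺`. -/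
def weightOf (p : PolyMonoid b) : DominantWeight b :=
  ⟨∑ i, (p.1 i).natDegree • fundWeight b i, fun j => ⟨(p.1 j).natDegree, by
    simp [fundWeight_simpleCoroot]⟩⟩

theorem weightOf_eval (p : PolyMonoid b) (i : b.support) :
    weightEval (weightOf p) i = (p.1 i).natDegree := by
  have h := weightEval_spec (weightOf p) i
  have h' : ((weightOf p : DominantWeight b) : Module.Dual ℂ H) (simpleCoroot b i)
      = (p.1 i).natDegree := by
    simp [weightOf, fundWeight_simpleCoroot]
  exact_mod_cast h.symm.trans h'

/-! ## Weyl modules -/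

variable (𝔤) in
/-- The universal enveloping algebra `U(L(𝔤))`. -/
abbrev ULoop : Type u := UniversalEnvelopingAlgebra ℂ (Loop 𝔤)

/-- The element `f ⊗ x` of `L(𝔤)`, viewed in `U(L(𝔤))`. -/
def loopElem (f : ℂ[T;T⁻¹]) (x : 𝔤) : ULoop 𝔤 :=
  UniversalEnvelopingAlgebra.ι ℂ (loopTmul f x)

/-- The power series `exp (- ∑_{k ≥ 1} (h_i ⊗ t ^ (s k)) / k * u ^ k)` over `U(L(𝔤))`. For `s = 1`
this is `P_i⁺(u)`, for `s = -1` it is `P_i⁻(u)`. -/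
def cartanSeries (i : b.support) (s : ℤ) : PowerSeries (ULoop 𝔤) :=
  expSeries <| PowerSeries.mk fun k =>
    if k = 0 then 0 else
      -((k : ℂ)⁻¹ • loopElem (LaurentPolynomial.T (s * k)) (simpleCoroot b i : 𝔤))

/-- `WeylRelation c π y` says that `y ∈ U(L(𝔤))` is one of the elements that the defining relations
of `W(π)` require to kill the generator `w_π`. -/
inductive WeylRelation (c : ChevalleyGenerators b) (p : PolyMonoid b) : ULoop 𝔤 → Prop
  | raising (f : ℂ[T;T⁻¹]) (x : 𝔤) (hx : x ∈ nPlus b) :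
      WeylRelation c p (loopElem f x)
  | cartan (h : H) :
      WeylRelation c p (loopElem 1 (h : 𝔤) -
        algebraMap ℂ (ULoop 𝔤) ((weightOf p : Module.Dual ℂ H) h))
  | lowering (i : b.support) :
      WeylRelation c p (loopElem 1 (c.xMinus i) ^ (weightEval (weightOf p) i + 1))
  | seriesPlus (i : b.support) (m : ℕ) :
      WeylRelation c p (PowerSeries.coeff m (cartanSeries i 1) -
        algebraMap ℂ (ULoop 𝔤) ((p.1 i).coeff m))
  | seriesMinus (i : b.support) (m : ℕ) :
      WeylRelation c p (PowerSeries.coeff m (cartanSeries i (-1)) -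
        algebraMap ℂ (ULoop 𝔤) (((minus p).1 i).coeff m))

/-- The left ideal of `U(L(𝔤))` generated by the defining relations of `W(π)`. -/
def weylIdeal (c : ChevalleyGenerators b) (p : PolyMonoid b) :
    Submodule (ULoop 𝔤) (ULoop 𝔤) :=
  Submodule.span (ULoop 𝔤) {y | WeylRelation c p y}

/-- The Weyl module `W(π)`: the cyclic `U(L(𝔤))`-module with the defining relations above; its
generator `w_π` is the class of `1`. -/
abbrev WeylModule (c : ChevalleyGenerators b) (p : PolyMonoid b) : Type u :=
  ULoop 𝔤 ⧸ weylIdeal c p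

/-- The action of `L(𝔤)` on `W(π)`, through `L(𝔤) → U(L(𝔤))`. -/
instance (c : ChevalleyGenerators b) (p : PolyMonoid b) :
    LieRingModule (Loop 𝔤) (WeylModule c p) where
  bracket z w := UniversalEnvelopingAlgebra.ι ℂ z • w
  add_lie y z w := by simp only [map_add, add_smul]
  lie_add z v w := smul_add _ v w
  leibniz_lie y z w := by
    simp only [LieHom.map_lie, LieRing.of_associative_ring_bracket, sub_smul, mul_smul,
      sub_add_cancel]

theorem loop_lie_def (c : ChevalleyGenerators b) (p : PolyMonoid b) (z : Loop 𝔤)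
    (w : WeylModule c p) : ⁅z, w⁆ = UniversalEnvelopingAlgebra.ι ℂ z • w := rfl

instance (c : ChevalleyGenerators b) (p : PolyMonoid b) :
    LieModule ℂ (Loop 𝔤) (WeylModule c p) where
  smul_lie r z w := by simp only [loop_lie_def, map_smul, smul_assoc]
  lie_smul r z w := by simp only [loop_lie_def]; exact smul_comm _ _ _

end Simple

end LoopWeyl

end

/-! Let `g` be the product of the `t - a` over the distinct `a` such that `1 - a u` divides some
`π_i`. It suffices that `𝔤 ⊗ g ^ N ℂ[t, t⁻¹]` kills `w_π` for some `N`. In any factorization of `π`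
every such `a` occurs among the `a_r`, so `g ^ N` divides `∏ (t - a_r) ^ N` (`supportPoly_pow_dvd`),
and `N` depends on `π` alone. An ideal that kills the cyclic vector kills the module
(`lie_eq_zero_of_ideal`).

Cartan part: taking logarithms in the relations for `P_i^±` shows that `h_i ⊗ q` acts on `w_π` by
the sum of the values `q(a)` over the inverse roots `a` of `π_i` (`lie_coroot_weylGen`). Hence `𝔥 ⊗
g ℂ[t, t⁻¹]` kills `w_π`.

Lowering part: with `n = λ_π(h_i)`, the relation `(x_i^-) ^ (n + 1) w_π = 0` polarizes to all
products of `n + 1` operators `x_i^- ⊗ q_j` (`lowProd_eq_zero`). If every `q_j` is a multiple of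
`g`, applying `x_i^+` `n` times merges the factors into a nonzero multiple of `(x_i^- ⊗ ∏ q_j) w_π`.
So `x_i^- ⊗ g ^ (n + 1) q` kills `w_π` (`lie_pow_mul_lowering_eq_zero`).

The `x ∈ 𝔤` such that `x ⊗ g ^ k ℂ[t, t⁻¹]` kills `w_π` for some `k` form a Lie subalgebra. It
contains `𝔥`, `𝔫⁺` and all `x_i^-`, hence equals `𝔤` (`eq_top_of_generators`); a finite basis makes
`k` uniform. -/

noncomputable section

namespace LoopWeyl

open LieAlgebra LieAlgebra.IsKilling

universe u

/-! ### Generation of `𝔤` by `𝔥`, `𝔫⁺` and the simple lowering vectors -/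

section Generation

variable {𝔤 : Type u} [LieRing 𝔤] [LieAlgebra ℂ 𝔤] [FiniteDimensional ℂ 𝔤]
  [LieAlgebra.IsSimple ℂ 𝔤] {H : LieSubalgebra ℂ 𝔤} [H.IsCartanSubalgebra]

/-- A nonzero element of a root space pairs nontrivially with the opposite root space. -/
theorem exists_killingForm_ne_zero {χ : H → ℂ} {x : 𝔤} (hx : x ∈ rootSpace H χ) (hx0 : x ≠ 0) :
    ∃ y ∈ rootSpace H (-χ), killingForm ℂ 𝔤 x y ≠ 0 := by
  by_contra! h
  have := mem_ker_killingForm_of_mem_rootSpace_of_forall_rootSpace_neg ℂ 𝔤 H hx h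
  rw [LieAlgebra.IsKilling.ker_killingForm_eq_bot] at this
  exact hx0 (by simpa using this)

/-- A submodule containing a nonzero element of a root space contains the root space. -/
theorem rootSpace_le_of_mem {χ : LieModule.Weight ℂ H 𝔤} (hχ : χ.IsNonZero) {U : Submodule ℂ 𝔤}
    {x : 𝔤} (hx0 : x ≠ 0) (hx : x ∈ rootSpace H (χ : H → ℂ)) (hU : x ∈ U) :
    (rootSpace H (χ : H → ℂ)).toSubmodule ≤ U := by
  intro y hy
  obtain ⟨k, hk⟩ := (finrank_eq_one_iff_of_nonzero' (⟨x, hx⟩ : rootSpace H (χ : H → ℂ))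
    (by simpa using hx0)).mp (finrank_rootSpace_eq_one χ hχ) ⟨y, hy⟩
  have : y = k • x := by simpa using (congrArg Subtype.val hk).symm
  rw [this]
  exact U.smul_mem k hU

/-- If `χ(α^∨) > 0` then `ad` of a nonzero element of the root space of `-α` is injective on the
root space of `χ`. -/
theorem lie_ne_zero_of_pos (χ α : H.root) (hpos : 0 < (rootSystem H).pairingIn ℤ χ α)
    {f z : 𝔤} (hf : f ∈ rootSpace H (-(α.1 : H → ℂ))) (hf0 : f ≠ 0)
    (hz : z ∈ rootSpace H (χ.1 : H → ℂ)) (hz0 : z ≠ 0) : ⁅f, z⁆ ≠ 0 := by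
  intro h0
  have hα := H.isNonZero_coe_root α
  obtain ⟨h, e, f', t, he, hf'⟩ := exists_isSl2Triple_of_weight_isNonZero hα
  have hh := t.h_eq_coroot hα he hf'
  obtain ⟨k, hk⟩ := (finrank_eq_one_iff_of_nonzero'
    (⟨f, by simpa using hf⟩ : rootSpace H ((-α.1 : LieModule.Weight ℂ H 𝔤) : H → ℂ))
    (by simpa using hf0)).mp (finrank_rootSpace_eq_one (-α.1) hα.neg) ⟨f', by simpa using hf'⟩
  have hk' : f' = k • f := by simpa using (congrArg Subtype.val hk).symm
  -- If `f` killed `z`, then `z` would be primitive for the opposite triple `(-h, f', e)`, with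
  -- weight `-χ(α^∨) < 0`. In finite dimension such a weight is a natural number.
  have hP : IsSl2Triple.HasPrimitiveVectorWith t.symm z
      (-((rootSystem H).pairing χ α)) := by
    refine ⟨hz0, ?_, ?_⟩
    · rw [neg_lie, hh, rootSystem_pairing_apply, neg_smul]
      exact congrArg Neg.neg (lie_eq_smul_of_mem_rootSpace hz _)
    · rw [hk', smul_lie, h0, smul_zero]
  obtain ⟨n, hn⟩ := hP.exists_nat
  rw [← (rootSystem H).algebraMap_pairingIn ℤ] at hn
  have : -((rootSystem H).pairingIn ℤ χ α) = (n : ℤ) := by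
    have h2 : ((-((rootSystem H).pairingIn ℤ χ α) : ℤ) : ℂ) = ((n : ℤ) : ℂ) := by
      simpa using hn
    exact_mod_cast h2
  omega

variable {b : (rootSystem H).Base}

/-- The root space of `-χ`, for `χ` positive, lies in every Lie subalgebra that contains the
`x_i^-`. -/
theorem rootSpace_neg_le (c : ChevalleyGenerators b) (U : LieSubalgebra ℂ 𝔤)
    (hneg : ∀ i, c.xMinus i ∈ U) {χ : H.root} (hχ : b.IsPos χ) :
    (rootSpace H ((-χ.1 : LieModule.Weight ℂ H 𝔤) : H → ℂ)).toSubmodule ≤ U.toSubmodule := by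
  have hx0 : ∀ i, c.xMinus i ≠ 0 := by
    intro i h
    have h1 := c.lie_xPlus_xMinus i
    rw [h, lie_zero, eq_comm] at h1
    have h2 : simpleCoroot b i = 0 := by exact_mod_cast h1
    exact (rootSystem H).ne_zero' i.1 h2
  generalize hN : b.height χ = N
  induction N using Int.induction_on generalizing χ with
  | zero => exact False.elim <| b.height_ne_zero χ hN
  | pred n ih =>
    rw [RootPairing.Base.isPos_iff] at hχ
    lia
  | succ n ih =>
    -- Induction on the height: unless `χ` is simple, `k = χ - j` is a positive root of height one
    -- less, for some simple `j` with `χ(j^∨) > 0`.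
    obtain ⟨j, hj, hj'⟩ := hχ.exists_mem_support_pos_pairingIn
    have hj'' := hj'
    rw [(rootSystem H).zero_lt_pairingIn_iff'] at hj'
    rcases eq_or_ne χ j with rfl | hij
    · exact rootSpace_le_of_mem (H.isNonZero_coe_root χ).neg (hx0 ⟨χ, hj⟩)
        (c.xMinus_mem ⟨χ, hj⟩) (hneg _)
    obtain ⟨k, hk⟩ := (rootSystem H).root_sub_root_mem_of_pairingIn_pos hj' hij
    have hkn : b.height k = n := by
      rw [b.height_sub hk, RootPairing.Base.height_one_of_mem_support hj]; lia
    have hkpos : b.IsPos k := by rw [RootPairing.Base.isPos_iff']; lia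
    obtain ⟨z, hz, hz0⟩ := χ.1.exists_ne_zero
    have hfz := lie_ne_zero_of_pos χ j hj' (c.xMinus_mem ⟨j, hj⟩) (hx0 _) hz hz0
    have hk' : (k.1 : H → ℂ) = -(j.1 : H → ℂ) + (χ.1 : H → ℂ) := by
      ext x
      have := congrArg (fun φ : Module.Dual ℂ H => φ x) hk
      simp at this
      simp [this]; ring
    have hmem : ⁅c.xMinus ⟨j, hj⟩, z⁆ ∈ rootSpace H (k.1 : H → ℂ) := by
      rw [hk']
      exact lie_mem_genWeightSpace_of_mem_genWeightSpace (c.xMinus_mem ⟨j, hj⟩) hz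
    -- `ad x_j^-` is nonzero from the root space of `χ` to that of `k`. By invariance of the Killing
    -- form, its transpose, from the root space of `-k` to that of `-χ`, is nonzero too.
    obtain ⟨y, hy, hzy⟩ := exists_killingForm_ne_zero hmem hfz
    have hyU : y ∈ U := ih hkpos hkn (by simpa using hy)
    have hne : ⁅c.xMinus ⟨j, hj⟩, y⁆ ≠ 0 := by
      intro h0
      apply hzy
      rw [← lie_skew, map_neg, LinearMap.neg_apply, LieModule.traceForm_apply_lie_apply, h0,
        map_zero, neg_zero]
    have hmem' : ⁅c.xMinus ⟨j, hj⟩, y⁆ ∈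
        rootSpace H ((-χ.1 : LieModule.Weight ℂ H 𝔤) : H → ℂ) := by
      have := lie_mem_genWeightSpace_of_mem_genWeightSpace (c.xMinus_mem ⟨j, hj⟩) hy
      convert! this using 2
      rw [hk']; simp
    exact rootSpace_le_of_mem (H.isNonZero_coe_root χ).neg hne hmem' (U.lie_mem (hneg _) hyU)

/-- `𝔤` is generated by `𝔥`, `𝔫⁺` and the `x_i^-`. -/
theorem eq_top_of_generators (c : ChevalleyGenerators b) (U : LieSubalgebra ℂ 𝔤)
    (hH : ∀ h : H, (h : 𝔤) ∈ U) (hpos : ∀ x ∈ nPlus b, x ∈ U) (hneg : ∀ i, c.xMinus i ∈ U)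
    (x : 𝔤) :
    x ∈ U := by
  have htop := LieAlgebra.cartan_sup_iSup_rootSpace_eq_top (K := ℂ) (L := 𝔤) (H := H)
  suffices h : (H.toLieSubmodule ⊔ ⨆ α : LieModule.Weight ℂ H 𝔤, ⨆ (_ : α.IsNonZero),
      rootSpace H α).toSubmodule ≤ U.toSubmodule by
    rw [htop] at h
    exact h trivial
  simp only [LieSubmodule.sup_toSubmodule, LieSubmodule.iSup_toSubmodule, sup_le_iff, iSup_le_iff]
  refine ⟨fun y hy => hH ⟨y, by simpa using hy⟩, fun α hα => ?_⟩
  have hα' : α ∈ H.root := by simpa using hα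
  rcases RootPairing.Base.IsPos.or_neg b ⟨α, hα'⟩ with h | h
  · exact (le_iSup (fun α : {α : H.root // b.IsPos α} =>
      (rootSpace H (α.1.1 : H → ℂ)).toSubmodule) ⟨⟨α, hα'⟩, h⟩).trans hpos
  · have := rootSpace_neg_le c U hneg h
    have hroot : ((((rootSystem H).reflectionPerm ⟨α, hα'⟩ ⟨α, hα'⟩).1 : LieModule.Weight ℂ H 𝔤) :
        H → ℂ) = -(α : H → ℂ) := by
      ext x
      have := (rootSystem H).root_reflectionPerm ⟨α, hα'⟩ ⟨α, hα'⟩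
      rw [RootPairing.reflection_apply_self] at this
      exact congrArg (fun φ : Module.Dual ℂ H => φ x) this
    convert! this using 3
    rw [LieModule.Weight.coe_neg]
    exact (neg_eq_iff_eq_neg.2 hroot).symm

end Generation

/-! ### Exponentials of power series and power sums -/

section ExpSeries

open PowerSeries

variable {A : Type*} [Ring A]

theorem coeff_pow_eq_zero {F : PowerSeries A} (hF : coeff 0 F = 0) {k m : ℕ} (h : m < k) :
    coeff m (F ^ k) = 0 := by
  induction k generalizing m with
  | zero => omega
  | succ k ih =>
    rw [pow_succ, coeff_mul]
    refine Finset.sum_eq_zero fun ij hij => ?_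
    rw [Finset.HasAntidiagonal.mem_antidiagonal] at hij
    by_cases h1 : ij.1 < k
    · rw [ih h1, zero_mul]
    · have : ij.2 = 0 := by omega
      rw [this, hF, mul_zero]

theorem coeff_zero_expSeries [Algebra ℂ A] (F : PowerSeries A) : coeff 0 (expSeries F) = 1 := by
  simp [expSeries]

/-- `(exp F)' = exp F * F'`. -/
theorem derivative_expSeries {F : PowerSeries ℂ} (hF : coeff 0 F = 0) :
    derivative ℂ (expSeries F) = expSeries F * derivative ℂ F := by
  ext m
  have h1 : coeff m (derivative ℂ (expSeries F)) =
      ∑ k ∈ Finset.range (m + 1), ((k.factorial : ℂ)⁻¹) • coeff m (F ^ k * derivative ℂ F) := by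
    rw [coeff_derivative, expSeries, coeff_mk, Finset.sum_mul, Finset.sum_range_succ']
    have h0 : ((Nat.factorial 0 : ℂ)⁻¹ • coeff (m + 1) (F ^ 0)) * ((m : ℂ) + 1) = 0 := by
      simp [coeff_one]
    rw [h0, add_zero]
    refine Finset.sum_congr rfl fun k _ => ?_
    rw [smul_mul_assoc, ← coeff_derivative, Derivation.leibniz_pow]
    simp only [Nat.add_sub_cancel, smul_eq_mul, nsmul_eq_mul, Nat.factorial_succ]
    have hk : (k : ℂ) + 1 ≠ 0 := by exact_mod_cast Nat.succ_ne_zero k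
    have hc : coeff m (((k + 1 : ℕ) : PowerSeries ℂ) * (F ^ k * derivative ℂ F)) =
        ((k : ℂ) + 1) * coeff m (F ^ k * derivative ℂ F) := by
      rw [← nsmul_eq_mul, map_nsmul, nsmul_eq_mul]; push_cast; rfl
    rw [hc]
    push_cast
    have hf : ((k.factorial : ℕ) : ℂ) ≠ 0 := by exact_mod_cast k.factorial_ne_zero
    field_simp
  rw [h1, coeff_mul]
  have h2 : ∀ ij ∈ Finset.HasAntidiagonal.antidiagonal m,
      coeff ij.1 (expSeries F) * coeff ij.2 (derivative ℂ F) =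
      ∑ k ∈ Finset.range (m + 1), ((k.factorial : ℂ)⁻¹) •
        (coeff ij.1 (F ^ k) * coeff ij.2 (derivative ℂ F)) := by
    intro ij hij
    rw [Finset.HasAntidiagonal.mem_antidiagonal] at hij
    rw [expSeries, coeff_mk, Finset.sum_mul]
    -- The truncation of the exponential depends on the coefficient; a common range is allowed
    -- because `F ^ k` has order at least `k`.
    have : Finset.range (ij.1 + 1) ⊆ Finset.range (m + 1) :=
      Finset.range_subset_range.2 (by omega)
    rw [Finset.sum_subset this]
    · simp only [smul_eq_mul, mul_assoc]
    · intro k _ hk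
      rw [Finset.mem_range, not_lt] at hk
      rw [coeff_pow_eq_zero hF (by omega), smul_zero, zero_mul]
  rw [Finset.sum_congr rfl h2, Finset.sum_comm]
  refine Finset.sum_congr rfl fun k _ => ?_
  rw [← Finset.smul_sum, coeff_mul]

/-- The equation `y' = y G` determines the coefficients of `y` recursively from the constant term,
since `m + 1` is invertible in `ℂ`. -/
theorem eq_of_derivative_eq_mul {E P G : PowerSeries ℂ} (h0 : coeff 0 E = coeff 0 P)
    (hE : derivative ℂ E = E * G) (hP : derivative ℂ P = P * G) : E = P := by
  ext m
  induction m using Nat.strong_induction_on with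
  | _ m ih =>
    rcases m with _ | m
    · exact h0
    have hm : (m : ℂ) + 1 ≠ 0 := by exact_mod_cast Nat.succ_ne_zero m
    apply mul_right_cancel₀ hm
    rw [← coeff_derivative, ← coeff_derivative, hE, hP, coeff_mul, coeff_mul]
    refine Finset.sum_congr rfl fun ij hij => ?_
    rw [Finset.HasAntidiagonal.mem_antidiagonal] at hij
    rw [ih _ (by omega)]

/-- The power series `- ∑_{k ≥ 1} p_k u ^ k / k`, where `p_k` is the `k`-th power sum of `s`. -/
def negLogSeries (s : Multiset ℂ) : PowerSeries ℂ :=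
  mk fun k => if k = 0 then 0 else -((k : ℂ)⁻¹ * (s.map fun a => a ^ k).sum)

theorem derivative_negLogSeries (s : Multiset ℂ) :
    derivative ℂ (negLogSeries s) = mk fun k => -(s.map fun a => a ^ (k + 1)).sum := by
  ext k
  have hk : (k : ℂ) + 1 ≠ 0 := by exact_mod_cast Nat.succ_ne_zero k
  rw [coeff_derivative, negLogSeries, coeff_mk, coeff_mk, if_neg (Nat.succ_ne_zero k)]
  push_cast
  field_simp

/-- `exp (- ∑_{k ≥ 1} p_k u ^ k / k) = ∏ (1 - a u)`. -/
theorem expSeries_negLogSeries (s : Multiset ℂ) :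
    expSeries (negLogSeries s) =
      (((s.map fun a => 1 - Polynomial.C a * Polynomial.X).prod : Polynomial ℂ) :
        PowerSeries ℂ) := by
  have h0 : coeff 0 (negLogSeries s) = 0 := by simp [negLogSeries]
  refine eq_of_derivative_eq_mul ?_ (derivative_expSeries h0) ?_
  · rw [coeff_zero_expSeries, Polynomial.coeff_coe, Polynomial.coeff_zero_multiset_prod,
      Multiset.map_map]
    refine (Multiset.prod_eq_one fun y hy => ?_).symm
    obtain ⟨z, -, rfl⟩ := Multiset.mem_map.1 hy
    simp
  · rw [derivative_negLogSeries]
    clear h0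
    induction s using Multiset.induction_on with
    | empty =>
      simp only [Multiset.map_zero, Multiset.prod_zero, Multiset.sum_zero, neg_zero,
        Polynomial.coe_one, Derivation.map_one_eq_zero]
      symm
      convert! mul_zero _
    | cons a s ih =>
      have hsplit : (mk fun k => -((a ::ₘ s).map fun a => a ^ (k + 1)).sum : PowerSeries ℂ) =
          (mk fun k => -a ^ (k + 1)) + mk fun k => -(s.map fun a => a ^ (k + 1)).sum := by
        ext k
        simp [add_comm]
      -- The logarithmic derivative of `1 - a u` is `-a / (1 - a u)`, a geometric series.
      have hlin : (1 - C a * X : PowerSeries ℂ) * (mk fun k => -a ^ (k + 1)) = -C a := by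
        ext k
        rcases k with _ | k
        · simp [sub_mul, mul_assoc]
        · simp [sub_mul, mul_assoc, coeff_succ_X_mul]
          ring
      rw [hsplit, Multiset.map_cons, Multiset.prod_cons, Polynomial.coe_mul, Derivation.leibniz, ih]
      simp only [smul_eq_mul, Polynomial.coe_sub, Polynomial.coe_one, Polynomial.coe_mul,
        Polynomial.coe_C, Polynomial.coe_X]
      have hd : derivative ℂ (1 - C a * X : PowerSeries ℂ) = -C a := by
        ext k
        rcases k with _ | k <;> simp
      rw [hd, ← hlin]
      ring

variable [Algebra ℂ A] {V : Type*} [AddCommGroup V] [Module ℂ V] [Module A V] [IsScalarTower ℂ A V]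
  {w : V} {F : PowerSeries A} {f : PowerSeries ℂ}

/-- Eigenvalues on the same vector multiply, even if the operators do not commute. The first two
alternatives dispense with the eigenvector condition at indices where a factor vanishes. -/
theorem coeff_mul_smul {G : PowerSeries A} {g : PowerSeries ℂ} {m : ℕ}
    (h : ∀ ij ∈ Finset.HasAntidiagonal.antidiagonal m,
      (coeff ij.1 G = 0 ∧ coeff ij.1 g = 0) ∨ (coeff ij.2 F = 0 ∧ coeff ij.2 f = 0) ∨
      (coeff ij.1 G • w = coeff ij.1 g • w ∧ coeff ij.2 F • w = coeff ij.2 f • w)) :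
    coeff m (G * F) • w = coeff m (g * f) • w := by
  rw [coeff_mul, coeff_mul, Finset.sum_smul, Finset.sum_smul]
  refine Finset.sum_congr rfl fun ij hij => ?_
  rcases h ij hij with ⟨h1, h2⟩ | ⟨h1, h2⟩ | ⟨h1, h2⟩
  · simp [h1, h2]
  · simp [h1, h2]
  · rw [mul_smul, h2, ← algebraMap_smul A (coeff ij.2 f) w, ← mul_smul, ← Algebra.commutes,
      mul_smul, h1, algebraMap_smul, smul_smul, mul_comm]

theorem coeff_pow_smul {m : ℕ} (h : ∀ j < m, coeff j F • w = coeff j f • w) (k : ℕ) {i : ℕ}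
    (hi : i < m) : coeff i (F ^ k) • w = coeff i (f ^ k) • w := by
  induction k generalizing i with
  | zero => by_cases h0 : i = 0 <;> simp [coeff_one, h0]
  | succ k ih =>
    rw [pow_succ, pow_succ]
    refine coeff_mul_smul fun ij hij => Or.inr (Or.inr ?_)
    rw [Finset.HasAntidiagonal.mem_antidiagonal] at hij
    exact ⟨ih (by omega), h _ (by omega)⟩

/-- If `w` is an eigenvector of the coefficients of `exp F`, then also of those of `F`. -/
theorem coeff_smul_of_expSeries (hF : coeff 0 F = 0) (hf : coeff 0 f = 0)
    (h : ∀ m, coeff m (expSeries F) • w = coeff m (expSeries f) • w) (m : ℕ) :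
    coeff m F • w = coeff m f • w := by
  induction m using Nat.strong_induction_on with
  | _ m ih =>
    rcases m with _ | m
    · rw [hF, hf, zero_smul, zero_smul]
    have hm := h (m + 1)
    simp only [expSeries, coeff_mk, Finset.sum_smul] at hm
    -- Split off `k = 0`, which contributes nothing, and `k = 1`, which is the wanted coefficient.
    -- The powers `k ≥ 2` only involve lower coefficients of `F`, because its constant term is zero.
    rw [Finset.sum_range_succ', Finset.sum_range_succ', Finset.sum_range_succ',
      Finset.sum_range_succ'] at hm
    have hk : ∀ k, coeff (m + 1) (F ^ (k + 1 + 1)) • w = coeff (m + 1) (f ^ (k + 1 + 1)) • w := by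
      intro k
      rw [pow_succ, pow_succ f]
      refine coeff_mul_smul fun ij hij => ?_
      rw [Finset.HasAntidiagonal.mem_antidiagonal] at hij
      by_cases h1 : ij.1 = 0
      · rw [h1, coeff_pow_eq_zero hF (by omega), coeff_pow_eq_zero hf (by omega)]
        exact Or.inl ⟨rfl, rfl⟩
      by_cases h2 : ij.2 = 0
      · rw [h2]
        exact Or.inr (Or.inl ⟨hF, hf⟩)
      exact Or.inr (Or.inr ⟨coeff_pow_smul ih _ (by omega), ih _ (by omega)⟩)
    simpa only [smul_assoc, hk, pow_zero, zero_add, pow_one, coeff_one, Nat.succ_ne_zero, if_false,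
      smul_zero, zero_smul, Nat.factorial_one, Nat.cast_one, inv_one, one_smul, add_zero,
      add_right_inj] using hm

end ExpSeries

/-! ### Bilinearity of `q ⊗ x` -/

section LoopTmul

variable {𝔤 : Type u} [LieRing 𝔤] [LieAlgebra ℂ 𝔤]

theorem loopTmul_add (q : ℂ[T;T⁻¹]) (x y : 𝔤) :
    loopTmul q (x + y) = loopTmul q x + loopTmul q y :=
  TensorProduct.tmul_add (R := ℂ) q x y

theorem add_loopTmul (q r : ℂ[T;T⁻¹]) (x : 𝔤) :
    loopTmul (q + r) x = loopTmul q x + loopTmul r x :=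
  TensorProduct.add_tmul (R := ℂ) q r x

theorem loopTmul_smul (q : ℂ[T;T⁻¹]) (k : ℂ) (x : 𝔤) : loopTmul q (k • x) = k • loopTmul q x :=
  TensorProduct.tmul_smul (R := ℂ) k q x

theorem smul_loopTmul (q : ℂ[T;T⁻¹]) (k : ℂ) (x : 𝔤) : loopTmul (k • q) x = k • loopTmul q x :=
  rfl

theorem loopTmul_zero (q : ℂ[T;T⁻¹]) : loopTmul q (0 : 𝔤) = 0 :=
  TensorProduct.tmul_zero (R := ℂ) _ q

end LoopTmul

/-! ### The `sl₂` computation with products of lowering operators -/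

section Lowering

variable {𝔤 : Type u} [LieRing 𝔤] [LieAlgebra ℂ 𝔤] {V : Type*} [AddCommGroup V]
  [LieRingModule (Loop 𝔤) V]

/-- The product of the operators `q ⊗ f`, for `q` in a list, applied to a vector. -/
def lowProd (f : 𝔤) (v : V) (L : List ℂ[T;T⁻¹]) : V :=
  L.foldr (fun q v => ⁅loopTmul q f, v⁆) v

theorem lowProd_cons (f : 𝔤) (v : V) (q : ℂ[T;T⁻¹]) (L : List ℂ[T;T⁻¹]) :
    lowProd f v (q :: L) = ⁅loopTmul q f, lowProd f v L⁆ := rfl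

theorem lowProd_append (f : 𝔤) (v : V) (L L' : List ℂ[T;T⁻¹]) :
    lowProd f v (L ++ L') = lowProd f (lowProd f v L') L := by
  simp [lowProd]

theorem lie_loopTmul_comm (f : 𝔤) (q r : ℂ[T;T⁻¹]) (v : V) :
    ⁅loopTmul q f, ⁅loopTmul r f, v⁆⁆ = ⁅loopTmul r f, ⁅loopTmul q f, v⁆⁆ := by
  rw [leibniz_lie, lie_loopTmul, lie_self, loopTmul_zero, zero_lie, zero_add]

theorem lowProd_add (f : 𝔤) (v v' : V) (L : List ℂ[T;T⁻¹]) :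
    lowProd f (v + v') L = lowProd f v L + lowProd f v' L := by
  induction L with
  | nil => rfl
  | cons q L ih => rw [lowProd_cons, lowProd_cons, lowProd_cons, ih, lie_add]

variable [Module ℂ V] [LieModule ℂ (Loop 𝔤) V] {e f h : 𝔤}

theorem lowProd_smul (f : 𝔤) (k : ℂ) (v : V) (L : List ℂ[T;T⁻¹]) :
    lowProd f (k • v) L = k • lowProd f v L := by
  induction L with
  | nil => rfl
  | cons q L ih => rw [lowProd_cons, lowProd_cons, ih, lie_smul]

theorem lie_multiset_sum {ι : Type*} (x : Loop 𝔤) (s : Multiset ι) (F : ι → V) :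
    ⁅x, (s.map F).sum⁆ = (s.map fun i => ⁅x, F i⁆).sum := by
  simpa using map_multiset_sum (LieModule.toEnd ℂ (Loop 𝔤) V x) (s.map F)

/-- Commuting `g ⊗ h` past a product of lowering operators. -/
theorem exists_lie_cartan_lowProd (hhf : ⁅h, f⁆ = (-2 : ℂ) • f) (K : Ideal ℂ[T;T⁻¹])
    (g : ℂ[T;T⁻¹]) (v : V) (L : List ℂ[T;T⁻¹]) :
    ∃ s : Multiset (List ℂ[T;T⁻¹]), s.card = L.length ∧
      (∀ L' ∈ s, L'.length = L.length ∧ L'.prod = g * L.prod ∧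
        ((∀ q ∈ L, q ∈ K) → ∀ q ∈ L', q ∈ K)) ∧
      ⁅loopTmul g h, lowProd f v L⁆ =
        lowProd f ⁅loopTmul g h, v⁆ L + (-2 : ℂ) • (s.map (lowProd f v)).sum := by
  induction L with
  | nil => exact ⟨0, rfl, by simp, by simp [lowProd]⟩
  | cons q L ih =>
    obtain ⟨s, hs, hs', hsum⟩ := ih
    refine ⟨((g * q) :: L) ::ₘ s.map (fun L' => q :: L'), by simp [hs], ?_, ?_⟩
    · intro L' hL'
      rw [Multiset.mem_cons, Multiset.mem_map] at hL'
      rcases hL' with rfl | ⟨M, hM, rfl⟩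
      · refine ⟨by simp, by simp [mul_assoc], fun hK r hr => ?_⟩
        rcases List.mem_cons.1 hr with rfl | hr
        · exact K.mul_mem_left _ (hK _ (by simp))
        · exact hK _ (by simp [hr])
      · obtain ⟨h1, h2, h3⟩ := hs' M hM
        refine ⟨by simp [h1], by simp [h2]; ring, fun hK r hr => ?_⟩
        rcases List.mem_cons.1 hr with rfl | hr
        · exact hK _ (by simp)
        · exact h3 (fun r hr => hK r (by simp [hr])) r hr
    · rw [lowProd_cons, leibniz_lie, lie_loopTmul, hhf, loopTmul_smul, hsum, lie_add, lie_smul,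
        lie_multiset_sum, Multiset.map_cons, Multiset.sum_cons, Multiset.map_map, lowProd_cons,
        lowProd_cons, smul_lie, smul_add]
      simp only [Function.comp_def, lowProd_cons]
      abel

/-- If a power of `1 ⊗ f` kills a vector which is an eigenvector of all the `q ⊗ h`, then so do all
products of the same length of operators `q ⊗ f`. -/
theorem lowProd_eq_zero (hhf : ⁅h, f⁆ = (-2 : ℂ) • f) {w : V}
    (hw : ∀ q, ∃ r : ℂ, ⁅loopTmul q h, w⁆ = r • w) {n : ℕ}
    (hn : lowProd f w (List.replicate n 1) = 0) (L : List ℂ[T;T⁻¹]) (hL : L.length = n) :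
    lowProd f w L = 0 := by
  -- Factors `1 ⊗ f` are replaced one at a time. Applying `g ⊗ h` to a vanishing product with `m +
  -- 1` factors `1 ⊗ f`, every term is zero by induction except those where `g` lands on one of
  -- these factors; they add up with coefficient `-2 (m + 1) ≠ 0`.
  have key : ∀ k m, k + m = n → ∀ L : List ℂ[T;T⁻¹], L.length = k →
      lowProd f (lowProd f w (List.replicate m 1)) L = 0 := by
    intro k
    induction k with
    | zero =>
      intro m hm L hL
      rw [List.length_eq_zero_iff.1 hL, show m = n by omega]
      exact hn
    | succ k ih =>
      intro m hm L hL
      obtain ⟨g, L, rfl⟩ := List.exists_cons_of_length_eq_add_one hL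
      have hL : L.length = k := by simpa using hL
      have ih := ih (m + 1) (by omega)
      have hrep : ∀ m, ∃ r : ℂ, ⁅loopTmul g h, lowProd f w (List.replicate m 1)⁆ =
          r • lowProd f w (List.replicate m 1) +
            (-2 * m : ℂ) • lowProd f w (g :: List.replicate (m - 1) 1) := by
        intro m
        induction m with
        | zero =>
          obtain ⟨r, hr⟩ := hw g
          exact ⟨r, by simp [lowProd, hr]⟩
        | succ m ihm =>
          obtain ⟨r, hr⟩ := ihm
          refine ⟨r, ?_⟩
          rw [List.replicate_succ, lowProd_cons, leibniz_lie, lie_loopTmul, hhf, mul_one,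
            loopTmul_smul, hr, lie_add, lie_smul, lie_smul, lowProd_cons, lie_loopTmul_comm,
            smul_lie, Nat.add_sub_cancel, lowProd_cons]
          have : (m : ℂ) • ⁅loopTmul g f, ⁅loopTmul 1 f,
              lowProd f w (List.replicate (m - 1) (1 : ℂ[T;T⁻¹]))⁆⁆ =
              (m : ℂ) • ⁅loopTmul g f, lowProd f w (List.replicate m (1 : ℂ[T;T⁻¹]))⁆ := by
            rcases m with _ | m
            · simp
            · rfl
          rw [mul_smul, this]
          push_cast
          module
      obtain ⟨r, hr⟩ := hrep (m + 1)
      obtain ⟨s, -, hs, hsum⟩ := exists_lie_cartan_lowProd hhf ⊤ g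
        (lowProd f w (List.replicate (m + 1) 1)) L
      have h0 : (s.map (lowProd f (lowProd f w (List.replicate (m + 1) 1)))).sum = 0 := by
        refine Multiset.sum_eq_zero fun v hv => ?_
        obtain ⟨L', hL', rfl⟩ := Multiset.mem_map.1 hv
        exact ih L' ((hs L' hL').1.trans hL)
      rw [ih L hL, lie_zero, h0, smul_zero, add_zero, hr, lowProd_add, lowProd_smul, lowProd_smul,
        ih L hL, smul_zero, zero_add, Nat.add_sub_cancel] at hsum
      have hm0 : (-2 * ((m + 1 : ℕ) : ℂ)) ≠ 0 := by
        have : ((m + 1 : ℕ) : ℂ) ≠ 0 := by exact_mod_cast Nat.succ_ne_zero m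
        simpa using this
      have h1 := (smul_eq_zero.1 hsum.symm).resolve_left hm0
      rw [← lowProd_append] at h1 ⊢
      have hcomm : ∀ M : List ℂ[T;T⁻¹], lowProd f w (L ++ g :: M) = lowProd f w (g :: L ++ M) := by
        clear * -
        intro M
        induction L with
        | nil => rfl
        | cons q L ih =>
          rw [List.cons_append, lowProd_cons, ih, List.cons_append, lowProd_cons,
            lie_loopTmul_comm]
          rfl
      rw [← hcomm]
      exact h1
  simpa [lowProd] using key n 0 (by omega) L hL

/-- Commuting `1 ⊗ e` past a product of lowering operators. -/
theorem exists_lie_raising_lowProd (hef : ⁅e, f⁆ = h) (hhf : ⁅h, f⁆ = (-2 : ℂ) • f)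
    (K : Ideal ℂ[T;T⁻¹]) {w : V} (he : ⁅loopTmul 1 e, w⁆ = 0)
    (hK : ∀ q ∈ K, ⁅loopTmul q h, w⁆ = 0) (L : List ℂ[T;T⁻¹]) (hL : ∀ q ∈ L, q ∈ K) :
    ∃ s : Multiset (List ℂ[T;T⁻¹]), s.card = L.length.choose 2 ∧
      (∀ L' ∈ s, L'.length + 1 = L.length ∧ L'.prod = L.prod ∧ ∀ q ∈ L', q ∈ K) ∧
      ⁅loopTmul 1 e, lowProd f w L⁆ = (-2 : ℂ) • (s.map (lowProd f w)).sum := by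
  induction L with
  | nil => exact ⟨0, rfl, by simp, by simpa [lowProd] using he⟩
  | cons q L ih =>
    have hL' : ∀ q ∈ L, q ∈ K := fun r hr => hL r (by simp [hr])
    obtain ⟨s, hs, hs', hsum⟩ := ih hL'
    obtain ⟨t, ht, ht', htsum⟩ := exists_lie_cartan_lowProd hhf K q w L
    refine ⟨t + s.map (fun L' => q :: L'), ?_, ?_, ?_⟩
    -- Each term merges a pair of factors of the product; Pascal's rule counts the pairs.
    · rw [Multiset.card_add, Multiset.card_map, hs, ht, List.length_cons, Nat.choose_succ_succ',
        Nat.choose_one_right]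
    · intro M hM
      rw [Multiset.mem_add, Multiset.mem_map] at hM
      rcases hM with hM | ⟨M, hM, rfl⟩
      · obtain ⟨h1, h2, h3⟩ := ht' M hM
        exact ⟨by simp [h1], by simp [h2], h3 hL'⟩
      · obtain ⟨h1, h2, h3⟩ := hs' M hM
        refine ⟨by simp [h1], by simp [h2], fun r hr => ?_⟩
        rcases List.mem_cons.1 hr with rfl | hr
        · exact hL _ (by simp)
        · exact h3 r hr
    · have h0 : lowProd f (0 : V) L = 0 := by simpa using lowProd_smul f 0 (0 : V) L
      rw [lowProd_cons, leibniz_lie, lie_loopTmul, one_mul, hef, htsum, hK q (hL q (by simp)), h0,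
        zero_add, hsum, lie_smul, lie_multiset_sum, Multiset.map_add, Multiset.sum_add, smul_add,
        Multiset.map_map]
      rfl

/-- Applying a power of `1 ⊗ e` to a product of lowering operators. -/
theorem exists_pow_raising_lowProd (hef : ⁅e, f⁆ = h) (hhf : ⁅h, f⁆ = (-2 : ℂ) • f)
    (K : Ideal ℂ[T;T⁻¹]) {w : V} (he : ⁅loopTmul 1 e, w⁆ = 0)
    (hK : ∀ q ∈ K, ⁅loopTmul q h, w⁆ = 0) (k : ℕ) :
    ∃ r : ℂ, r ≠ 0 ∧ ∀ L : List ℂ[T;T⁻¹], L.length = k + 1 → (∀ q ∈ L, q ∈ K) →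
      (LieModule.toEnd ℂ (Loop 𝔤) V (loopTmul 1 e) ^ k) (lowProd f w L) =
        r • ⁅loopTmul L.prod f, w⁆ := by
  induction k with
  | zero =>
    refine ⟨1, one_ne_zero, fun L hL _ => ?_⟩
    obtain ⟨q, rfl⟩ := List.length_eq_one_iff.1 hL
    simp [lowProd]
  | succ k ih =>
    obtain ⟨r, hr, ih⟩ := ih
    -- Merging preserves the product of the list, so all `(k + 2).choose 2` terms contribute the
    -- same vector and cannot cancel.
    refine ⟨-2 * ((k + 2).choose 2 : ℕ) * r, ?_, fun L hL hLK => ?_⟩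
    · have : ((k + 2).choose 2 : ℂ) ≠ 0 := by
        exact_mod_cast (Nat.choose_pos (by omega)).ne'
      simp [hr, this]
    obtain ⟨s, hs, hs', hsum⟩ := exists_lie_raising_lowProd hef hhf K he hK L hLK
    rw [pow_succ, Module.End.mul_apply, LieModule.toEnd_apply_apply, hsum, map_smul,
      map_multiset_sum, Multiset.map_map]
    have : s.map ((LieModule.toEnd ℂ (Loop 𝔤) V (loopTmul 1 e) ^ k) ∘ lowProd f w) =
        s.map fun _ => r • ⁅loopTmul L.prod f, w⁆ := by
      refine Multiset.map_congr rfl fun M hM => ?_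
      obtain ⟨h1, h2, h3⟩ := hs' M hM
      rw [Function.comp_apply, ih M (by omega) h3, h2]
    rw [this, Multiset.map_const', Multiset.sum_replicate, hs, hL, ← Nat.cast_smul_eq_nsmul ℂ]
    module

/-- If all the `g q ⊗ h` kill a highest weight vector, then so do all the `g ^ n q ⊗ f`. -/
theorem lie_pow_mul_lowering_eq_zero (hef : ⁅e, f⁆ = h) (hhf : ⁅h, f⁆ = (-2 : ℂ) • f) {w : V}
    (he : ⁅loopTmul 1 e, w⁆ = 0) (hw : ∀ q, ∃ r : ℂ, ⁅loopTmul q h, w⁆ = r • w)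
    {g : ℂ[T;T⁻¹]} (hg : ∀ q, ⁅loopTmul (g * q) h, w⁆ = 0) {n : ℕ}
    (hn : lowProd f w (List.replicate (n + 1) 1) = 0) (q : ℂ[T;T⁻¹]) :
    ⁅loopTmul (g ^ (n + 1) * q) f, w⁆ = 0 := by
  have hK : ∀ r ∈ Ideal.span {g}, ⁅loopTmul r h, w⁆ = 0 := by
    intro r hr
    obtain ⟨s, rfl⟩ := Ideal.mem_span_singleton.1 hr
    exact hg s
  obtain ⟨r, hr, hr'⟩ := exists_pow_raising_lowProd hef hhf _ he hK n
  have hlen : ((g * q) :: List.replicate n g).length = n + 1 := by simp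
  have h1 := hr' ((g * q) :: List.replicate n g) hlen (fun s hs => by
    rcases List.mem_cons.1 hs with rfl | hs
    · exact Ideal.mul_mem_right _ _ (Ideal.mem_span_singleton_self g)
    · rw [List.eq_of_mem_replicate hs]
      exact Ideal.mem_span_singleton_self g)
  rw [lowProd_eq_zero hhf hw hn _ hlen, map_zero] at h1
  have h2 := (smul_eq_zero.1 h1.symm).resolve_left hr
  rw [List.prod_cons, List.prod_replicate] at h2
  rwa [show g ^ (n + 1) * q = g * q * g ^ n by ring]

end Lowering

/-! ### Annihilation of the generator, then of the whole Weyl module -/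

section Weyl

variable {𝔤 : Type u} [LieRing 𝔤] [LieAlgebra ℂ 𝔤] [FiniteDimensional ℂ 𝔤]
  [LieAlgebra.IsSimple ℂ 𝔤] {H : LieSubalgebra ℂ 𝔤} [H.IsCartanSubalgebra]
  {b : (rootSystem H).Base}

open Classical in
/-- The inverse of a nonzero complex number, as a unit. -/
def unitInv (z : ℂ) : ℂˣ := if h : z = 0 then 1 else (Units.mk0 z h)⁻¹

theorem coe_unitInv {z : ℂ} (h : z ≠ 0) : (unitInv z : ℂ) = z⁻¹ := by
  simp [unitInv, h]

/-- The multiset of the `a` for which `1 - a u` is a factor of `π_i`. -/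
def invRoots (p : PolyMonoid b) (i : b.support) : Multiset ℂˣ := (p.1 i).roots.map unitInv

theorem root_ne_zero (p : PolyMonoid b) (i : b.support) {z : ℂ} (hz : z ∈ (p.1 i).roots) :
    z ≠ 0 := by
  rintro rfl
  have h := Polynomial.isRoot_of_mem_roots hz
  rw [Polynomial.IsRoot, ← Polynomial.coeff_zero_eq_eval_zero, p.2 i] at h
  exact one_ne_zero h

theorem card_invRoots (p : PolyMonoid b) (i : b.support) :
    (invRoots p i).card = (p.1 i).natDegree := by
  rw [invRoots, Multiset.card_map]
  exact (Polynomial.splits_iff_card_roots.1 (IsAlgClosed.splits _))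

/-- Since `1 - z⁻¹ u = -z⁻¹ (u - z)`, both sides are proportional; the constant term `1` fixes the
scalar. -/
theorem eq_prod_invRoots (p : PolyMonoid b) (i : b.support) :
    p.1 i = (((invRoots p i).map fun a : ℂˣ => (a : ℂ)).map
      fun a => 1 - Polynomial.C a * Polynomial.X).prod := by
  have h1 : (((invRoots p i).map fun a : ℂˣ => (a : ℂ)).map
      fun a => 1 - Polynomial.C a * Polynomial.X).prod =
      Polynomial.C (((p.1 i).roots.map fun z => -z⁻¹).prod) *
        ((p.1 i).roots.map fun z => Polynomial.X - Polynomial.C z).prod := by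
    rw [map_multiset_prod, Multiset.map_map (_ : ℂ → ℂ[X]) (_ : ℂ → ℂ),
      ← Multiset.prod_map_mul, invRoots, Multiset.map_map, Multiset.map_map]
    refine congrArg _ (Multiset.map_congr rfl fun z hz => ?_)
    have hz0 := root_ne_zero p i hz
    simp only [Function.comp_apply, coe_unitInv hz0]
    rw [mul_sub, ← Polynomial.C_mul, neg_mul, inv_mul_cancel₀ hz0]
    simp
    ring
  have h2 := (IsAlgClosed.splits (p.1 i)).eq_prod_roots
  have h3 : (((invRoots p i).map fun a : ℂˣ => (a : ℂ)).map
      fun a => 1 - Polynomial.C a * Polynomial.X).prod.coeff 0 = 1 := by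
    rw [Polynomial.coeff_zero_multiset_prod, Multiset.map_map]
    refine Multiset.prod_eq_one fun y hy => ?_
    obtain ⟨z, -, rfl⟩ := Multiset.mem_map.1 hy
    simp
  have h4 := p.2 i
  rw [h1, Polynomial.coeff_C_mul] at h3
  rw [h2, Polynomial.coeff_C_mul] at h4
  rw [h1]
  conv_lhs => rw [h2]
  have h5 := mul_right_cancel₀ (right_ne_zero_of_mul_eq_one h3) (h4.trans h3.symm)
  rw [h5]

theorem minus_eq_prod_invRoots (p : PolyMonoid b) (i : b.support) :
    (minus p).1 i = (((invRoots p i).map fun a => ((a⁻¹ : ℂˣ) : ℂ)).map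
      fun a => 1 - Polynomial.C a * Polynomial.X).prod := by
  rw [minus, invRoots, Multiset.map_map, Multiset.map_map]
  refine congrArg _ (Multiset.map_congr rfl fun z hz => ?_)
  have hz0 := root_ne_zero p i hz
  simp [coe_unitInv hz0]

variable (c : ChevalleyGenerators b) (p : PolyMonoid b)

/-- The generator `w_π` of the Weyl module. -/
def weylGen : WeylModule c p := Submodule.Quotient.mk 1

variable {c p}

theorem smul_weylGen (y : ULoop 𝔤) : y • weylGen c p = Submodule.Quotient.mk y := by
  rw [weylGen, ← Submodule.Quotient.mk_smul, smul_eq_mul, mul_one]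

theorem smul_weylGen_eq_zero {y : ULoop 𝔤} (h : WeylRelation c p y) : y • weylGen c p = 0 := by
  rw [smul_weylGen, Submodule.Quotient.mk_eq_zero]
  exact Submodule.subset_span h

theorem smul_weylGen_eq {y : ULoop 𝔤} {r : ℂ}
    (h : WeylRelation c p (y - algebraMap ℂ (ULoop 𝔤) r)) :
    y • weylGen c p = r • weylGen c p := by
  have := smul_weylGen_eq_zero h
  rwa [sub_smul, sub_eq_zero, algebraMap_smul] at this

theorem exists_smul_weylGen (w : WeylModule c p) : ∃ y : ULoop 𝔤, w = y • weylGen c p := by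
  obtain ⟨y, rfl⟩ := Submodule.Quotient.mk_surjective _ w
  exact ⟨y, (smul_weylGen y).symm⟩

theorem lie_T_weylGen_of_series (i : b.support) (s : ℤ) (S : Multiset ℂ)
    (h : ∀ m, WeylRelation c p (PowerSeries.coeff m (cartanSeries i s) -
      algebraMap ℂ (ULoop 𝔤)
        ((S.map fun a => 1 - Polynomial.C a * Polynomial.X).prod.coeff m)))
    (k : ℕ) (hk : k ≠ 0) :
    ⁅loopTmul (LaurentPolynomial.T (s * k)) (simpleCoroot b i : 𝔤), weylGen c p⁆ =
      (S.map fun a => a ^ k).sum • weylGen c p := by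
  have h1 : ∀ m, PowerSeries.coeff m (cartanSeries i s : PowerSeries (ULoop 𝔤)) • weylGen c p =
      PowerSeries.coeff m (expSeries (negLogSeries S)) • weylGen c p := by
    intro m
    rw [expSeries_negLogSeries, Polynomial.coeff_coe]
    exact smul_weylGen_eq (h m)
  have h2 := coeff_smul_of_expSeries (by simp) (by simp [negLogSeries]) h1 k
  rw [PowerSeries.coeff_mk, negLogSeries, PowerSeries.coeff_mk, if_neg hk, if_neg hk, neg_smul,
    neg_smul, neg_inj, smul_assoc, mul_smul] at h2
  have hk' : ((k : ℂ)⁻¹) ≠ 0 := inv_ne_zero (Nat.cast_ne_zero.2 hk)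
  exact smul_right_injective _ hk' h2

/-- Positive `n` come from `P_i^+` and negative `n` from `P_i^-`. For `n = 0` the weight relation
gives `λ_π(h_i) = deg π_i`, the number of inverse roots. -/
theorem lie_T_weylGen (i : b.support) (n : ℤ) :
    ⁅loopTmul (LaurentPolynomial.T n) (simpleCoroot b i : 𝔤), weylGen c p⁆ =
      ((invRoots p i).map fun a => ((a ^ n : ℂˣ) : ℂ)).sum • weylGen c p := by
  rcases lt_trichotomy n 0 with hn | rfl | hn
  · obtain ⟨k, rfl⟩ : ∃ k : ℕ, n = -1 * k := ⟨n.natAbs, by omega⟩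
    rw [lie_T_weylGen_of_series i (-1) ((invRoots p i).map fun a => ((a⁻¹ : ℂˣ) : ℂ))
      (fun m => by rw [← minus_eq_prod_invRoots]; exact .seriesMinus i m) k (by omega),
      Multiset.map_map]
    simp
  · have h := smul_weylGen_eq (WeylRelation.cartan (c := c) (p := p) (simpleCoroot b i))
    rw [weightEval_spec, weightOf_eval, ← card_invRoots] at h
    rw [LaurentPolynomial.T_zero]
    simpa only [zpow_zero, Units.val_one, Multiset.map_const', Multiset.sum_replicate,
      nsmul_eq_mul, mul_one] using! h
  · obtain ⟨k, rfl⟩ : ∃ k : ℕ, n = 1 * k := ⟨n.natAbs, by omega⟩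
    rw [lie_T_weylGen_of_series i 1 ((invRoots p i).map fun a : ℂˣ => (a : ℂ))
      (fun m => by rw [← eq_prod_invRoots]; exact .seriesPlus i m) k (by omega),
      Multiset.map_map]
    simp

/-- Evaluation of a Laurent polynomial at a nonzero complex number. -/
def evalAt (a : ℂˣ) : ℂ[T;T⁻¹] →+* ℂ := LaurentPolynomial.eval₂ (RingHom.id ℂ) a

theorem lie_coroot_weylGen (i : b.support) (q : ℂ[T;T⁻¹]) :
    ⁅loopTmul q (simpleCoroot b i : 𝔤), weylGen c p⁆ =
      ((invRoots p i).map fun a => evalAt a q).sum • weylGen c p := by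
  induction q using LaurentPolynomial.induction_on' with
  | add q r hq hr =>
    rw [add_loopTmul, add_lie, hq, hr, ← add_smul, ← Multiset.sum_map_add]
    simp
  | C_mul_T n r =>
    rw [← LaurentPolynomial.smul_eq_C_mul, smul_loopTmul, smul_lie, lie_T_weylGen,
      LaurentPolynomial.smul_eq_C_mul, smul_smul, ← Multiset.sum_map_mul_left]
    simp [evalAt]

open Classical in
/-- The set of all `a` for which `1 - a u` is a factor of some `π_i`. -/
def invRootSet (p : PolyMonoid b) : Finset ℂˣ :=
  Finset.univ.biUnion fun i => (invRoots p i).toFinset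

theorem mem_invRootSet {a : ℂˣ} : a ∈ invRootSet p ↔ ∃ i, a ∈ invRoots p i := by
  simp [invRootSet]

/-- The product of the `t - a`, for `a` in the support of `π`. -/
def supportPoly (p : PolyMonoid b) : ℂ[T;T⁻¹] :=
  ∏ a ∈ invRootSet p, (LaurentPolynomial.T 1 - LaurentPolynomial.C (a : ℂ))

theorem evalAt_supportPoly {a : ℂˣ} (ha : a ∈ invRootSet p) : evalAt a (supportPoly p) = 0 := by
  rw [supportPoly, map_prod]
  refine Finset.prod_eq_zero ha ?_
  simp [evalAt]

theorem lie_supportPoly_coroot (i : b.support) (q : ℂ[T;T⁻¹]) :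
    ⁅loopTmul (supportPoly p * q) (simpleCoroot b i : 𝔤), weylGen c p⁆ = 0 := by
  rw [lie_coroot_weylGen, Multiset.sum_eq_zero, zero_smul]
  intro x hx
  obtain ⟨a, ha, rfl⟩ := Multiset.mem_map.1 hx
  rw [map_mul, evalAt_supportPoly (mem_invRootSet.2 ⟨i, ha⟩), zero_mul]

theorem lie_supportPoly_cartan (h : H) (q : ℂ[T;T⁻¹]) :
    ⁅loopTmul (supportPoly p * q) (h : 𝔤), weylGen c p⁆ = 0 := by
  have hh : h ∈ Submodule.span ℂ ((rootSystem H).coroot '' b.support) := by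
    rw [b.span_coroot_support]
    have htop : (rootSystem H).corootSpan ℂ = ⊤ := RootPairing.IsRootSystem.span_coroot_eq_top
    rw [htop]
    trivial
  induction hh using Submodule.span_induction with
  | mem h hh =>
    obtain ⟨i, hi, rfl⟩ := hh
    exact lie_supportPoly_coroot ⟨i, hi⟩ q
  | zero => rw [ZeroMemClass.coe_zero, loopTmul_zero, zero_lie]
  | add x y _ _ hx hy => rw [Submodule.coe_add, loopTmul_add, add_lie, hx, hy, add_zero]
  | smul k x _ hx => rw [Submodule.coe_smul, loopTmul_smul, smul_lie, hx, smul_zero]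

theorem xPlus_mem_nPlus (i : b.support) : c.xPlus i ∈ nPlus b :=
  Submodule.mem_iSup_of_mem (p := fun α : {α : H.root // b.IsPos α} =>
    (rootSpace H (α.1.1 : H → ℂ)).toSubmodule)
    ⟨i, b.isPos_of_mem_support i.2⟩ (c.xPlus_mem i)

theorem lie_simpleCoroot_xMinus (i : b.support) :
    ⁅(simpleCoroot b i : 𝔤), c.xMinus i⁆ = (-2 : ℂ) • c.xMinus i := by
  have h := lie_eq_smul_of_mem_rootSpace (α := -(i.1.1 : H → ℂ)) (c.xMinus_mem i)
    (simpleCoroot b i)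
  have h2 : (i.1.1 : H → ℂ) (simpleCoroot b i) = 2 :=
    root_apply_coroot (H.isNonZero_coe_root i.1)
  rw [Pi.neg_apply, h2] at h
  exact h

theorem lowProd_replicate_one (x : 𝔤) (n : ℕ) :
    lowProd x (weylGen c p) (List.replicate n 1) = loopElem 1 x ^ n • weylGen c p := by
  induction n with
  | zero => simp [lowProd]
  | succ n ih =>
    rw [List.replicate_succ, lowProd_cons, ih, pow_succ', mul_smul]
    rfl

theorem lie_supportPoly_xMinus (i : b.support) (q : ℂ[T;T⁻¹]) :
    ⁅loopTmul (supportPoly p ^ (weightEval (weightOf p) i + 1) * q) (c.xMinus i),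
      weylGen c p⁆ = 0 :=
  lie_pow_mul_lowering_eq_zero (c.lie_xPlus_xMinus i) (lie_simpleCoroot_xMinus i)
    (smul_weylGen_eq_zero (.raising 1 _ (xPlus_mem_nPlus i)))
    (fun q => ⟨_, lie_coroot_weylGen i q⟩) (fun q => lie_supportPoly_coroot i q)
    ((lowProd_replicate_one _ _).trans (smul_weylGen_eq_zero (.lowering i))) q

variable (c p) in
/-- The Lie algebra of all `x` for which some `x ⊗ g ^ k ℂ[t, t⁻¹]` kills `w_π`, where `g` is the
support polynomial of `π`. -/
def killingSubalgebra : LieSubalgebra ℂ 𝔤 where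
  carrier := {x | ∃ k, ∀ q, ⁅loopTmul (supportPoly p ^ k * q) x, weylGen c p⁆ = 0}
  zero_mem' := ⟨0, fun q => by rw [loopTmul_zero, zero_lie]⟩
  add_mem' {x y} := by
    rintro ⟨k, hk⟩ ⟨l, hl⟩
    refine ⟨k + l, fun q => ?_⟩
    rw [loopTmul_add, add_lie, pow_add, mul_assoc, hk, mul_left_comm, hl, add_zero]
  smul_mem' r x := by
    rintro ⟨k, hk⟩
    exact ⟨k, fun q => by rw [loopTmul_smul, smul_lie, hk, smul_zero]⟩
  lie_mem' {x y} := by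
    rintro ⟨k, hk⟩ ⟨l, hl⟩
    refine ⟨k + l, fun q => ?_⟩
    -- `g ^ (k + l) q ⊗ [x, y]` is the commutator of `g ^ k ⊗ x` and `g ^ l q ⊗ y`, both of which
    -- kill `w_π`.
    have h1 := hk 1
    rw [mul_one] at h1
    rw [pow_add, mul_assoc, ← lie_loopTmul, lie_lie, hl, h1, lie_zero, lie_zero, sub_zero]

theorem exists_pow_supportPoly (c : ChevalleyGenerators b) (p : PolyMonoid b) :
    ∃ N, ∀ q (x : 𝔤), ⁅loopTmul (supportPoly p ^ N * q) x, weylGen c p⁆ = 0 := by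
  have htop : ∀ x : 𝔤, x ∈ killingSubalgebra c p := by
    refine eq_top_of_generators c _ ?_ ?_ ?_
    · exact fun h => ⟨1, fun q => by rw [pow_one]; exact lie_supportPoly_cartan h q⟩
    · exact fun x hx => ⟨0, fun q => smul_weylGen_eq_zero (.raising _ x hx)⟩
    · exact fun i => ⟨_, lie_supportPoly_xMinus i⟩
  let B := Module.finBasis ℂ 𝔤
  choose k hk using fun j => htop (B j)
  refine ⟨∑ j, k j, fun q x => ?_⟩
  induction B.mem_span x using Submodule.span_induction with
  | zero => rw [loopTmul_zero, zero_lie]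
  | add x y _ _ hx hy => rw [loopTmul_add, add_lie, hx, hy, add_zero]
  | smul r x _ hx => rw [loopTmul_smul, smul_lie, hx, smul_zero]
  | mem x hx =>
    -- Raising the exponent is harmless, as the surplus power of `g` is absorbed into `q`.
    obtain ⟨j, rfl⟩ := hx
    have : ∑ j, k j = k j + (∑ j, k j - k j) :=
      (Nat.add_sub_cancel' (Finset.single_le_sum (fun _ _ => Nat.zero_le _)
        (Finset.mem_univ j))).symm
    rw [this, pow_add, mul_assoc]
    exact hk j _

/-- Every subalgebra of the enveloping algebra that contains the Lie algebra is everything. -/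
theorem mem_of_ι_mem {L : Type*} [LieRing L] [LieAlgebra ℂ L]
    (S : Subalgebra ℂ (UniversalEnvelopingAlgebra ℂ L))
    (hS : ∀ x, UniversalEnvelopingAlgebra.ι ℂ x ∈ S) (y : UniversalEnvelopingAlgebra ℂ L) :
    y ∈ S := by
  let φ : L →ₗ⁅ℂ⁆ S :=
    { toFun := fun x => ⟨UniversalEnvelopingAlgebra.ι ℂ x, hS x⟩
      map_add' := fun x y => Subtype.ext (map_add _ x y)
      map_smul' := fun r x => Subtype.ext (map_smul _ r x)
      map_lie' := fun {x y} => Subtype.ext (LieHom.map_lie _ x y) }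
  have h : S.val.comp (UniversalEnvelopingAlgebra.lift ℂ φ) = AlgHom.id ℂ _ := by
    ext x
    simp [φ]
  have := congrArg (fun ψ => ψ y) h
  simp only [AlgHom.comp_apply, AlgHom.id_apply] at this
  rw [← this]
  exact (UniversalEnvelopingAlgebra.lift ℂ φ y).2

/-- An ideal of the loop algebra that kills `w_π` kills the Weyl module. -/
theorem lie_eq_zero_of_ideal {I : LieIdeal ℂ (Loop 𝔤)} (hI : ∀ z ∈ I, ⁅z, weylGen c p⁆ = 0)
    {z : Loop 𝔤} (hz : z ∈ I) (w : WeylModule c p) : ⁅z, w⁆ = 0 := by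
  -- `S` consists of the elements that preserve the space of vectors killed by `I`. It contains the
  -- Lie algebra because `z x v = [z, x] v + x z v` and `I` is an ideal.
  let S : Subalgebra ℂ (ULoop 𝔤) :=
    { carrier := {y | ∀ v : WeylModule c p, (∀ z ∈ I, ⁅z, v⁆ = 0) → ∀ z ∈ I, ⁅z, y • v⁆ = 0}
      mul_mem' := fun {x y} hx hy v hv => by
        simp only [mul_smul]
        exact hx _ (hy v hv)
      add_mem' := fun {x y} hx hy v hv z hz => by
        rw [add_smul, lie_add, hx v hv z hz, hy v hv z hz, add_zero]
      algebraMap_mem' := fun r v hv z hz => by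
        rw [algebraMap_smul, lie_smul, hv z hz, smul_zero] }
  obtain ⟨y, rfl⟩ := exists_smul_weylGen w
  refine mem_of_ι_mem S (fun x v hv z hz => ?_) y _ hI z hz
  rw [← loop_lie_def, leibniz_lie, hv z hz, lie_zero, add_zero]
  exact hv _ (lie_mem_left ℂ _ I z x hz)

end Weyl

/-! ### Finite dimension of the truncated loop algebra -/

section Truncation

variable {𝔤 : Type u} [LieRing 𝔤] [LieAlgebra ℂ 𝔤] {l : ℕ} (a : Fin l → ℂˣ) (N : ℕ)

/-- The class of `t` is a root of the monic `∏ (X - a_r) ^ N`, and the inverse of an algebraic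
element is algebraic. So the quotient is integral and of finite type over `ℂ`, hence finite. -/
theorem finite_quotient_truncPoly :
    Module.Finite ℂ (ℂ[T;T⁻¹] ⧸ Ideal.span {truncPoly a N}) := by
  let π := Ideal.Quotient.mkₐ ℂ (Ideal.span {truncPoly a N})
  have h1 : IsIntegral ℂ (π (LaurentPolynomial.T 1)) := by
    refine ⟨∏ r, (Polynomial.X - Polynomial.C (a r : ℂ)) ^ N,
      Polynomial.monic_prod_of_monic _ _ fun r _ => (Polynomial.monic_X_sub_C _).pow N, ?_⟩
    have h0 : π (∏ r, (LaurentPolynomial.T 1 - LaurentPolynomial.C (a r : ℂ)) ^ N) = 0 :=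
      Ideal.Quotient.eq_zero_iff_mem.2 (Ideal.mem_span_singleton_self _)
    rw [← h0, map_prod, Polynomial.eval₂_finsetProd]
    refine Finset.prod_congr rfl fun r _ => ?_
    rw [Polynomial.eval₂_pow, Polynomial.eval₂_sub, Polynomial.eval₂_X, Polynomial.eval₂_C,
      map_pow, map_sub, LaurentPolynomial.C_eq_algebraMap, AlgHom.commutes]
  have hmul : π (LaurentPolynomial.T (-1)) * π (LaurentPolynomial.T 1) = 1 := by
    rw [← map_mul, ← LaurentPolynomial.T_add, neg_add_cancel, LaurentPolynomial.T_zero, map_one]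
  let inv : Invertible (π (LaurentPolynomial.T 1)) :=
    ⟨π (LaurentPolynomial.T (-1)), hmul, (mul_comm _ _).trans hmul⟩
  have h2 : IsIntegral ℂ (π (LaurentPolynomial.T (-1))) := by
    change IsIntegral ℂ (⅟(π (LaurentPolynomial.T 1)))
    rwa [← isAlgebraic_iff_isIntegral, IsAlgebraic.invOf_iff, isAlgebraic_iff_isIntegral]
  have hT : ∀ n : ℤ, IsIntegral ℂ (π (LaurentPolynomial.T n)) := by
    intro n
    rcases Int.eq_nat_or_neg n with ⟨k, rfl | rfl⟩
    · have := h1.pow k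
      rwa [← map_pow, LaurentPolynomial.T_pow, mul_one] at this
    · have := h2.pow k
      rwa [← map_pow, LaurentPolynomial.T_pow, mul_neg, mul_one] at this
  have : Algebra.IsIntegral ℂ (ℂ[T;T⁻¹] ⧸ Ideal.span {truncPoly a N}) := by
    refine ⟨fun y => ?_⟩
    obtain ⟨q, rfl⟩ := Ideal.Quotient.mkₐ_surjective ℂ (Ideal.span {truncPoly a N}) y
    induction q using LaurentPolynomial.induction_on' with
    | add q r hq hr => rw [map_add]; exact hq.add hr
    | C_mul_T n r => rw [← LaurentPolynomial.smul_eq_C_mul, map_smul]; exact (hT n).smul r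
  have : Algebra.FiniteType ℂ ℂ[T;T⁻¹] := AddMonoidAlgebra.finiteType_of_fg ℂ ℤ
  exact Algebra.IsIntegral.finite

/-- The class of `q ⊗ x` in the truncation, as a bilinear map. -/
def truncMk : ℂ[T;T⁻¹] →ₗ[ℂ] 𝔤 →ₗ[ℂ] Truncation 𝔤 a N :=
  LinearMap.mk₂ ℂ (fun q x => LieSubmodule.Quotient.mk (loopTmul q x))
    (fun q r x => by rw [add_loopTmul]; rfl)
    (fun k q x => by rw [smul_loopTmul]; rfl)
    (fun q x y => by rw [loopTmul_add]; rfl)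
    (fun k q x => by rw [loopTmul_smul]; rfl)

theorem finite_truncation [FiniteDimensional ℂ 𝔤] :
    FiniteDimensional ℂ (Truncation 𝔤 a N) := by
  have := finite_quotient_truncPoly a N
  let J := (Ideal.span {truncPoly a N}).restrictScalars ℂ
  have hJ : Module.Finite ℂ (ℂ[T;T⁻¹] ⧸ J) := Module.Finite.equiv
    (Submodule.Quotient.restrictScalarsEquiv ℂ (Ideal.span {truncPoly a N})).symm
  have hker : J ≤ LinearMap.ker (truncMk (𝔤 := 𝔤) a N) := by
    intro q hq
    obtain ⟨r, rfl⟩ := Ideal.mem_span_singleton.1 hq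
    rw [LinearMap.mem_ker]
    ext x
    exact LieSubmodule.Quotient.mk_eq_zero'.2 (Submodule.subset_span ⟨r, x, rfl⟩)
  refine Module.Finite.of_surjective (TensorProduct.lift (J.liftQ _ hker)) fun y => ?_
  obtain ⟨z, rfl⟩ := LieSubmodule.Quotient.surjective_mk' _ y
  induction z using loop_induction with
  | zero => exact ⟨0, by simp⟩
  | tmul q x => exact ⟨Submodule.Quotient.mk q ⊗ₜ x, rfl⟩
  | add z z' hz hz' =>
    obtain ⟨s, hs⟩ := hz
    obtain ⟨s', hs'⟩ := hz'
    exact ⟨s + s', by rw [map_add, hs, hs', map_add]⟩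

end Truncation

/-! ### Descent of an action to a quotient -/

section LiftQuotient

variable {L V : Type*} [LieRing L] [LieAlgebra ℂ L] [AddCommGroup V] [Module ℂ V]
  [LieRingModule L V] [LieModule ℂ L V]

theorem exists_quotient_action (I : LieIdeal ℂ L) (hI : ∀ z ∈ I, ∀ v : V, ⁅z, v⁆ = 0) :
    ∃ ρ : (L ⧸ I) →ₗ⁅ℂ⁆ Module.End ℂ V,
      ∀ (z : L) (v : V), ρ (LieSubmodule.Quotient.mk z) v = ⁅z, v⁆ := by
  refine ⟨{ I.toSubmodule.liftQ (LieModule.toEnd ℂ L V : L →ₗ[ℂ] Module.End ℂ V)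
      fun z hz => LinearMap.ext fun v => hI z hz v with
    map_lie' := fun {x y} => ?_ }, fun z v => rfl⟩
  obtain ⟨x, rfl⟩ := LieSubmodule.Quotient.surjective_mk' _ x
  obtain ⟨y, rfl⟩ := LieSubmodule.Quotient.surjective_mk' _ y
  exact LieHom.map_lie (LieModule.toEnd ℂ L V) x y

end LiftQuotient

/-! ### Independence of the chosen factorization -/

section Support

variable {𝔤 : Type u} [LieRing 𝔤] [LieAlgebra ℂ 𝔤] [FiniteDimensional ℂ 𝔤]
  [LieAlgebra.IsSimple ℂ 𝔤] {H : LieSubalgebra ℂ 𝔤} [H.IsCartanSubalgebra]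
  {b : (rootSystem H).Base} {p : PolyMonoid b}

theorem eval_linElem_ne_zero {i j : b.support} {a x : ℂˣ} (h : x ≠ a) :
    ((linElem j a).1 i).eval ((x⁻¹ : ℂˣ) : ℂ) ≠ 0 := by
  by_cases hij : i = j
  · simp only [linElem, hij, if_true, Polynomial.eval_sub, Polynomial.eval_one,
      Polynomial.eval_mul, Polynomial.eval_C, Polynomial.eval_X]
    intro h0
    apply h
    have : a * x⁻¹ = 1 := Units.ext (by simpa using (sub_eq_zero.1 h0).symm)
    exact (mul_inv_eq_one.1 this).symm
  · simp [linElem, hij]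

theorem eval_weightElem_ne_zero {i : b.support} {a x : ℂˣ} (μ : DominantWeight b) (h : x ≠ a) :
    ((weightElem μ a).1 i).eval ((x⁻¹ : ℂˣ) : ℂ) ≠ 0 := by
  rw [weightElem, Submonoid.coe_finsetProd, Finset.prod_apply, Polynomial.eval_prod]
  refine Finset.prod_ne_zero_iff.2 fun j _ => ?_
  rw [SubmonoidClass.coe_pow, Pi.pow_apply, Polynomial.eval_pow]
  exact pow_ne_zero _ (eval_linElem_ne_zero h)

/-- Some `π_i` vanishes at `x⁻¹`, hence so does the `i`-th component of one factor `π_{λ_r, a_r}`;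
this forces `a_r = x`. -/
theorem exists_eq_of_mem_invRootSet {l : ℕ} {μ : Fin l → DominantWeight b} {a : Fin l → ℂˣ}
    (hp : p = ∏ r, weightElem (μ r) (a r)) {x : ℂˣ} (hx : x ∈ invRootSet p) : ∃ r, a r = x := by
  obtain ⟨i, hi⟩ := mem_invRootSet.1 hx
  obtain ⟨z, hz, rfl⟩ := Multiset.mem_map.1 hi
  have hroot : (p.1 i).eval (((unitInv z)⁻¹ : ℂˣ) : ℂ) = 0 := by
    have := Polynomial.isRoot_of_mem_roots hz
    rw [Polynomial.IsRoot] at this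
    simpa [coe_unitInv (root_ne_zero p i hz)] using this
  by_contra! h
  rw [hp, Submonoid.coe_finsetProd, Finset.prod_apply, Polynomial.eval_prod] at hroot
  obtain ⟨r, -, hr⟩ := Finset.prod_eq_zero_iff.1 hroot
  exact eval_weightElem_ne_zero (μ r) (h r).symm hr

theorem supportPoly_pow_dvd {l : ℕ} {μ : Fin l → DominantWeight b} {a : Fin l → ℂˣ}
    (hp : p = ∏ r, weightElem (μ r) (a r)) (N : ℕ) : supportPoly p ^ N ∣ truncPoly a N := by
  classical
  rw [truncPoly, Finset.prod_pow]
  refine pow_dvd_pow_of_dvd ?_ N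
  -- The `a_r` may repeat: grouped by value, each distinct one occurs with exponent at least `1`,
  -- which suffices as `g` is squarefree.
  rw [Finset.prod_comp (fun x : ℂˣ => LaurentPolynomial.T 1 - LaurentPolynomial.C (x : ℂ)) a]
  have hsub : invRootSet p ⊆ Finset.univ.image a := by
    intro x hx
    obtain ⟨r, rfl⟩ := exists_eq_of_mem_invRootSet hp hx
    exact Finset.mem_image_of_mem a (Finset.mem_univ r)
  refine (Finset.prod_dvd_prod_of_subset _ _ _ hsub).trans
    (Finset.prod_dvd_prod_of_dvd _ _ fun x hx => dvd_pow_self _ ?_)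
  obtain ⟨r, -, rfl⟩ := Finset.mem_image.1 hx
  exact (Finset.card_pos.2 ⟨r, by simp⟩).ne'

end Support

end LoopWeyl

end

open LoopWeyl in
theorem mainTheorem3 {𝔤 : Type*} [LieRing 𝔤] [LieAlgebra ℂ 𝔤] [FiniteDimensional ℂ 𝔤]
    [LieAlgebra.IsSimple ℂ 𝔤] (H : LieSubalgebra ℂ 𝔤) [H.IsCartanSubalgebra]
    (b : (LieAlgebra.IsKilling.rootSystem H).Base) (c : ChevalleyGenerators b)
    (p : PolyMonoid b) :
    ∃ N : ℕ, ∀ (l : ℕ) (μ : Fin l → DominantWeight b) (a : Fin l → ℂˣ),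
      p = ∏ r, weightElem (μ r) (a r) →
        (∀ z ∈ truncIdeal 𝔤 a N, ∀ w : WeylModule c p, ⁅z, w⁆ = 0) ∧
        FiniteDimensional ℂ (Truncation 𝔤 a N) ∧
        ∃ ρ : Truncation 𝔤 a N →ₗ⁅ℂ⁆ Module.End ℂ (WeylModule c p),
          ∀ (z : Loop 𝔤) (w : WeylModule c p), ρ (LieSubmodule.Quotient.mk z) w = ⁅z, w⁆ := by
  obtain ⟨N, hN⟩ := exists_pow_supportPoly c p
  refine ⟨N, fun l μ a hp => ?_⟩
  have hgen : ∀ z ∈ truncIdeal 𝔤 a N, ⁅z, weylGen c p⁆ = 0 := by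
    intro z hz
    change z ∈ Submodule.span ℂ _ at hz
    induction hz using Submodule.span_induction with
    | mem z hz =>
      obtain ⟨q, x, rfl⟩ := hz
      obtain ⟨r, hr⟩ := supportPoly_pow_dvd hp N
      rw [hr, mul_assoc]
      exact hN _ x
    | zero => rw [zero_lie]
    | add x y _ _ hx hy => rw [add_lie, hx, hy, add_zero]
    | smul k x _ hx => rw [smul_lie, hx, smul_zero]
  have hkill : ∀ z ∈ truncIdeal 𝔤 a N, ∀ w : WeylModule c p, ⁅z, w⁆ = 0 :=
    fun z hz w => lie_eq_zero_of_ideal hgen hz w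
  exact ⟨hkill, finite_truncation a N, exists_quotient_action _ hkill⟩
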